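/- Let $H$ be a complex Hilbert space, and let $B(H)$ be the C$^*$-algebra of bounded linear operators on $H$, with unit $1$ and commutator $[x,y]=xy-yx$. A derivation on $B(H)$ is a linear map $D:B(H)\to B(H)$ with $D(ab)=D(a)b+aD(b)$ for all $a,b\in B(H)$. A (not necessarily linear or continuous) map $\Delta:B(H)\to B(H)$ is called a weak-2-local derivation if for all $x,y\in B(H)$ and every $\phi\in B(H)^*$ (the space of bounded linear functionals) there is a derivation $D$ on $B(H)$, depending on $x$, $y$ and $\phi$, such that $\phi(\Delta(x))=\phi(D(x))$ and $\phi(\Delta(y))=\phi(D(y))$. It is called symmetric if $\Delta=\Delta^\sharp$, where $\Delta^\sharp(x)=\Delta(x^*)^*$ for all $x\in B(H)$. Theorem (identity principle). Let $\Delta:B(H)\to B(H)$ be a symmetric weak-2-local derivation. Let $p_0\in B(H)$ be a finite-rank (orthogonal) projection, and let $z_0\in(1-p_0)B(H)(1-p_0)$ satisfy $z_0^*=-z_0$. Suppose that $$(1-p_0)\,\Delta(p)\,(1-p_0)=[z_0,p]$$ for every finite-rank projection $p\in(1-p_0)B(H)(1-p_0)$. Then $$(1-p_0)\,\Delta\big((1-p_0)a(1-p_0)\big)\,(1-p_0)=[z_0,(1-p_0)a(1-p_0)]$$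 for every $a\in B(H)$. If in addition $p_0=0$, then $\Delta=[z_0,\cdot]$ is a linear derivation on $B(H)$. -/

import Mathlib

/-- A linear derivation on an algebra `A`: a linear map satisfying the Leibniz rule.
(`Derivation` in Mathlib requires `A` to be commutative.) -/
def IsAlgDerivation {A : Type*} [Ring A] [Algebra ℂ A] (D : A →ₗ[ℂ] A) : Prop :=
  ∀ a b : A, D (a * b) = D a * b + a * D b

/-- A (not necessarily linear or continuous) map `Δ : X → Y` is a weak-2-local `S` map if for all
`x, y` in `X` and every continuous linear functional `φ` on `Y` there is `T` in `S` with
`φ (Δ x) = φ (T x)` and `φ (Δ y) = φ (T y)`. -/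
def IsWeak2Local {X Y : Type*} [NormedAddCommGroup X] [NormedSpace ℂ X]
    [NormedAddCommGroup Y] [NormedSpace ℂ Y] (S : Set (X →ₗ[ℂ] Y)) (Δ : X → Y) : Prop :=
  ∀ (x y : X) (φ : StrongDual ℂ Y), ∃ T ∈ S, φ (Δ x) = φ (T x) ∧ φ (Δ y) = φ (T y)

/-- A weak-2-local derivation on a normed algebra. -/
def IsWeak2LocalDerivation {A : Type*} [NormedRing A] [NormedAlgebra ℂ A] (Δ : A → A) : Prop :=
  IsWeak2Local {D : A →ₗ[ℂ] A | IsAlgDerivation D} Δ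

/-- The map `Δ^♯`, given by `Δ^♯ x = (Δ x*)*`. -/
def sharp {A B : Type*} [Star A] [Star B] (Δ : A → B) : A → B :=
  fun x => star (Δ (star x))

/-- `Δ` is symmetric if `Δ^♯ = Δ`. -/
def IsSymmetricMap {A B : Type*} [Star A] [Star B] (Δ : A → B) : Prop :=
  sharp Δ = Δ

/-- A bounded operator is of finite rank if its range is finite dimensional. -/
def IsFiniteRankOp {H : Type*} [NormedAddCommGroup H] [InnerProductSpace ℂ H]
    (T : H →L[ℂ] H) : Prop :=
  FiniteDimensional ℂ (LinearMap.range (T : H →ₗ[ℂ] H))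

/-!
The theorem holds because of an identity between `Δ` and the trace. A derivation `D` of `B(H)` is
implemented by a linear map `T` of `H`, `D a = T a - a T`, so `tr (F (D F)) = 0` for every `F` of
finite rank. If `Δ` is a weak-2-local derivation and `b`, `p` have finite rank, comparing `Δ` at `b`
and `p` through the functional `X ↦ tr ((b - p) X)` gives `tr ((b - p) (Δ b)) = tr ((b - p) (Δ p))`,
while `tr (b (Δ b)) = 0`. So, if `tr ((b - p) (Δ p)) = 0`, then `tr (p (Δ b)) = 0`; for `p` the
projection onto a unit vector `ξ` this says `⟪ξ, Δ b ξ⟫ = 0`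
(`IsWeak2LocalDerivation.inner_map_add_rankOne_eq_zero`).

To pass from finite rank to an arbitrary operator `a`, note that `p (D ((1 - p) a (1 - p))) p = 0`
for every derivation, so that `⟪ξ, Δ a ξ⟫` does not change when `(1 - p) a (1 - p)` is removed from
`a` (`IsWeak2LocalDerivation.inner_map_eq_of_sub`). What remains has rank at most two.

The hypothesis says that the weak-2-local derivation `Δ - [z₀, ·]`, compressed by `1 - p₀`,
vanishes at the rank one projections below `1 - p₀`. By the above its compression vanishes at all
operators `a` with `a = (1 - p₀) a (1 - p₀)`
(`IsWeak2LocalDerivation.compression_eq_zero`).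
-/

open InnerProductSpace in
/-- Every derivation of `B(H)` is implemented by a linear map of `H`, which need not be assumed
bounded. -/
theorem IsAlgDerivation.exists_apply_eq {H : Type*} [NormedAddCommGroup H] [InnerProductSpace ℂ H]
    {D : (H →L[ℂ] H) →ₗ[ℂ] (H →L[ℂ] H)} (hD : IsAlgDerivation D) :
    ∃ T : H →ₗ[ℂ] H, ∀ a x, D a x = T (a x) - a (T x) := by
  rcases subsingleton_or_nontrivial H with hH | hH
  · exact ⟨0, fun a x => Subsingleton.elim _ _⟩
  obtain ⟨f, hf⟩ := exists_norm_eq H zero_le_one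
  -- `T x = D (x ⊗ f) f`; apply the Leibniz rule to `a x ⊗ f = a (x ⊗ f)` and evaluate at `f`.
  refine ⟨{ toFun := fun x => D (rankOne ℂ x f) f, map_add' := by simp, map_smul' := by simp }, ?_⟩
  intro a x
  have h1 : rankOne ℂ (a x) f = a * rankOne ℂ x f := by ext y; simp
  simp only [LinearMap.coe_mk, AddHom.coe_mk]
  rw [h1, hD]
  simp [hf]

/-- The functional `X ↦ tr ((ξ ⊗ u + w ⊗ ξ) X)` on `B(H)`, written as
`X ↦ ⟪u, X ξ⟫ + ⟪ξ, X w⟫`. -/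
noncomputable def rankTwoFunctional {H : Type*} [NormedAddCommGroup H] [InnerProductSpace ℂ H]
    (ξ u w : H) : StrongDual ℂ (H →L[ℂ] H) :=
  (innerSL ℂ u).comp (ContinuousLinearMap.apply ℂ H ξ) +
    (innerSL ℂ ξ).comp (ContinuousLinearMap.apply ℂ H w)

theorem rankTwoFunctional_apply {H : Type*} [NormedAddCommGroup H] [InnerProductSpace ℂ H]
    (ξ u w : H) (X : H →L[ℂ] H) :
    rankTwoFunctional ξ u w X = inner ℂ u (X ξ) + inner ℂ ξ (X w) := by
  simp [rankTwoFunctional]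

open InnerProductSpace in
/-- `tr (F (D F)) = 0` for a derivation `D` and `F = ξ ⊗ u + w ⊗ ξ`. -/
theorem IsAlgDerivation.rankTwoFunctional_map_eq_zero {H : Type*} [NormedAddCommGroup H]
    [InnerProductSpace ℂ H] {D : (H →L[ℂ] H) →ₗ[ℂ] (H →L[ℂ] H)} (hD : IsAlgDerivation D)
    (ξ u w : H) :
    rankTwoFunctional ξ u w (D (rankOne ℂ ξ u + rankOne ℂ w ξ)) = 0 := by
  obtain ⟨T, hT⟩ := hD.exists_apply_eq
  rw [rankTwoFunctional_apply, hT, hT]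
  simp only [add_apply, rankOne_apply, map_add, map_smul, inner_sub_right,
    inner_add_right, inner_smul_right]
  ring

/-- If `p` is the projection onto `ξ` and `a - b = (1 - p) (a - b) (1 - p)`, then a weak-2-local
derivation satisfies `p (Δ a) p = p (Δ b) p`. -/
theorem IsWeak2LocalDerivation.inner_map_eq_of_sub {H : Type*} [NormedAddCommGroup H]
    [InnerProductSpace ℂ H] {Δ : (H →L[ℂ] H) → (H →L[ℂ] H)} (hΔ : IsWeak2LocalDerivation Δ)
    {ξ : H} {a b : H →L[ℂ] H} (hξ : (a - b) ξ = 0) (hξ' : ∀ x, inner ℂ ξ ((a - b) x) = 0) :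
    inner ℂ ξ (Δ a ξ) = inner ℂ ξ (Δ b ξ) := by
  obtain ⟨D, hD, ha, hb⟩ := hΔ a b ((innerSL ℂ ξ).comp (ContinuousLinearMap.apply ℂ H ξ))
  obtain ⟨T, hT⟩ := IsAlgDerivation.exists_apply_eq hD
  simp only [ContinuousLinearMap.comp_apply, ContinuousLinearMap.apply_apply,
    innerSL_apply_apply] at ha hb
  rw [ha, hb, ← sub_eq_zero, ← inner_sub_right, ← sub_apply, ← map_sub, hT, hξ,
    map_zero, zero_sub, inner_neg_right, hξ', neg_zero]

open InnerProductSpace in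
/-- With `p = ξ ⊗ ξ` and `b = ξ ⊗ u + w ⊗ ξ`: if `tr ((b - p) (Δ p)) = 0`, then
`tr (p (Δ b)) = 0`. -/
theorem IsWeak2LocalDerivation.inner_map_add_rankOne_eq_zero {H : Type*} [NormedAddCommGroup H]
    [InnerProductSpace ℂ H] {Δ : (H →L[ℂ] H) → (H →L[ℂ] H)} (hΔ : IsWeak2LocalDerivation Δ)
    {ξ u w : H} (hp : rankTwoFunctional ξ u (w - ξ) (Δ (rankOne ℂ ξ ξ)) = 0) :
    inner ℂ ξ (Δ (rankOne ℂ ξ u + rankOne ℂ w ξ) ξ) = 0 := by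
  set p := rankOne ℂ ξ ξ
  set b := rankOne ℂ ξ u + rankOne ℂ w ξ with hb
  have hbb : rankTwoFunctional ξ u w (Δ b) = 0 := by
    obtain ⟨D, hD, h, -⟩ := hΔ b b (rankTwoFunctional ξ u w)
    rw [h]
    exact IsAlgDerivation.rankTwoFunctional_map_eq_zero hD ξ u w
  have hbp : rankTwoFunctional ξ u (w - ξ) (Δ b) = 0 := by
    obtain ⟨D, hD, h1, h2⟩ := hΔ b p (rankTwoFunctional ξ u (w - ξ))
    have h3 : b - p = rankOne ℂ ξ u + rankOne ℂ (w - ξ) ξ := by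
      simp only [hb, p, map_sub, sub_apply]
      abel
    have h4 := IsAlgDerivation.rankTwoFunctional_map_eq_zero hD ξ u (w - ξ)
    rw [← h3, map_sub, map_sub, ← h1, ← h2, hp, sub_zero] at h4
    exact h4
  rw [rankTwoFunctional_apply] at hbb hbp
  rw [map_sub, inner_sub_right] at hbp
  linear_combination hbb - hbp

open InnerProductSpace in
/-- A weak-2-local derivation whose compression by a projection `q` vanishes at the rank one
projections below `q` has zero compression on the whole corner. -/
theorem IsWeak2LocalDerivation.compression_eq_zero {H : Type*} [NormedAddCommGroup H]
    [InnerProductSpace ℂ H] [CompleteSpace H] {Δ : (H →L[ℂ] H) → (H →L[ℂ] H)}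
    (hΔ : IsWeak2LocalDerivation Δ) {q : H →L[ℂ] H} (hq : IsStarProjection q)
    (h : ∀ ξ : H, ‖ξ‖ = 1 → q ξ = ξ → q * Δ (rankOne ℂ ξ ξ) * q = 0)
    {a : H →L[ℂ] H} (ha : q * a * q = a) : q * Δ a * q = 0 := by
  have hqq (x : H) : q (q x) = q x := congr($(hq.isIdempotentElem.eq) x)
  have hqadj : ContinuousLinearMap.adjoint q = q := hq.isSelfAdjoint.adjoint_eq
  have hqin (x y : H) : inner ℂ (q x) y = inner ℂ x (q y) := by
    conv_lhs => rw [← hqadj, ContinuousLinearMap.adjoint_inner_left]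
  have hqa (x : H) : q (a x) = a x := by
    have := congr($ha x)
    simp only [mul_apply_eq_comp] at this
    rw [← this, hqq]
  have hqa' (x : H) : q (ContinuousLinearMap.adjoint a x) = ContinuousLinearMap.adjoint a x := by
    refine ext_inner_right ℂ fun y => ?_
    have := congr($ha (q y))
    simp only [mul_apply_eq_comp, hqq] at this
    have h2 := congr($ha y)
    simp only [mul_apply_eq_comp] at h2
    rw [hqin, ContinuousLinearMap.adjoint_inner_left, ContinuousLinearMap.adjoint_inner_left,
      ← this, h2]
  have key (ξ : H) (hξ : ‖ξ‖ = 1) (hqξ : q ξ = ξ) : inner ℂ ξ (Δ a ξ) = 0 := by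
    have hξξ : (inner ℂ ξ ξ : ℂ) = 1 := by simp [inner_self_eq_norm_sq_to_K, hξ]
    -- `ξ ⊗ u + w ⊗ ξ` is `p a + a p - p a p` for `p = ξ ⊗ ξ`.
    set u := ContinuousLinearMap.adjoint a ξ with hu
    set w := a ξ - (inner ℂ ξ (a ξ) : ℂ) • ξ with hw
    have hqu : q u = u := hqa' ξ
    have hqw : q (w - ξ) = w - ξ := by simp [hw, hqa, hqξ]
    have huξ (x : H) : inner ℂ u x = inner ℂ ξ (a x) := by
      rw [hu, ContinuousLinearMap.adjoint_inner_left]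
    have hξw : (inner ℂ ξ w : ℂ) = 0 := by
      rw [hw, inner_sub_right, inner_smul_right, hξξ, mul_one, sub_self]
    rw [hΔ.inner_map_eq_of_sub (b := rankOne ℂ ξ u + rankOne ℂ w ξ)]
    · apply hΔ.inner_map_add_rankOne_eq_zero
      have hz (x y : H) (hx : q x = x) (hy : q y = y) :
          inner ℂ x (Δ (rankOne ℂ ξ ξ) y) = 0 := by
        have := congr(inner ℂ x ($(h ξ hξ hqξ) y))
        simpa only [mul_apply_eq_comp, hy, ← hqin, hx, zero_apply,
          inner_zero_right] using this
      rw [rankTwoFunctional_apply, hz u ξ hqu hqξ, hz ξ (w - ξ) hqξ hqw, add_zero]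
    · simp only [sub_apply, add_apply, rankOne_apply, huξ,
        hξξ, hw, one_smul]
      abel
    · intro x
      simp only [sub_apply, add_apply, rankOne_apply, huξ,
        inner_sub_right, inner_add_right, inner_smul_right, hξξ, hξw]
      ring
  suffices hs : ∀ x : H, inner ℂ (q x) (Δ a (q x)) = 0 by
    have hz : ((q * Δ a * q : H →L[ℂ] H) : H →ₗ[ℂ] H) = 0 := by
      refine (inner_map_self_eq_zero _).1 fun x => ?_
      rw [← inner_conj_symm]
      simp [← hqin, hs]
    exact ContinuousLinearMap.coe_injective hz
  intro x
  by_cases hx : q x = 0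
  · simp [hx]
  have hn : ‖q x‖ ≠ 0 := norm_ne_zero_iff.2 hx
  have := key (((‖q x‖ : ℂ)⁻¹) • q x) (by simp [norm_smul, hn]) (by simp [hqq])
  simpa [inner_smul_left, inner_smul_right, hn, hx] using this

/-- The inner derivation `[z, ·]` as a linear map. -/
noncomputable def innerDerivation {A : Type*} [Ring A] [Algebra ℂ A] (z : A) : A →ₗ[ℂ] A :=
  LinearMap.mulLeft ℂ z - LinearMap.mulRight ℂ z

theorem innerDerivation_apply {A : Type*} [Ring A] [Algebra ℂ A] (z a : A) :
    innerDerivation z a = ⁅z, a⁆ := by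
  simp [innerDerivation, Ring.lie_def]

theorem isAlgDerivation_innerDerivation {A : Type*} [Ring A] [Algebra ℂ A] (z : A) :
    IsAlgDerivation (innerDerivation z) := by
  intro a b
  simp only [innerDerivation_apply, Ring.lie_def]
  noncomm_ring

theorem IsWeak2LocalDerivation.sub_lie {A : Type*} [NormedRing A] [NormedAlgebra ℂ A]
    {Δ : A → A} (hΔ : IsWeak2LocalDerivation Δ) (z : A) :
    IsWeak2LocalDerivation fun x => Δ x - ⁅z, x⁆ := by
  intro x y φ
  obtain ⟨D, hD, hx, hy⟩ := hΔ x y φ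
  refine ⟨D - innerDerivation z, fun a b => ?_, ?_, ?_⟩
  · rw [LinearMap.sub_apply, LinearMap.sub_apply, LinearMap.sub_apply, hD,
      isAlgDerivation_innerDerivation z]
    noncomm_ring
  · simp [innerDerivation_apply, hx]
  · simp [innerDerivation_apply, hy]

/-- `[z, x]` stays in the corner of an idempotent `q` when `z` and `x` lie in it. -/
theorem IsIdempotentElem.mul_lie_mul_of_mem_corner {A : Type*} [Ring A] {q z x : A}
    (hq : IsIdempotentElem q) (hz : z ∈ Subsemigroup.corner q) (hx : x ∈ Subsemigroup.corner q) :
    q * ⁅z, x⁆ * q = ⁅z, x⁆ := by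
  obtain ⟨hz1, hz2⟩ := (Subsemigroup.mem_corner_iff hq).1 hz
  obtain ⟨hx1, hx2⟩ := (Subsemigroup.mem_corner_iff hq).1 hx
  rw [Ring.lie_def, mul_sub, sub_mul, ← mul_assoc, ← mul_assoc, hz1, hx1, mul_assoc, mul_assoc,
    hx2, hz2]

theorem mainTheorem8 {H : Type*} [NormedAddCommGroup H] [InnerProductSpace ℂ H] [CompleteSpace H]
    (Δ : (H →L[ℂ] H) → (H →L[ℂ] H))
    (hΔ : IsWeak2LocalDerivation Δ) (hsymm : IsSymmetricMap Δ)
    (p₀ : H →L[ℂ] H) (hp₀ : IsStarProjection p₀) (hp₀_fin : IsFiniteRankOp p₀)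
    (z₀ : H →L[ℂ] H) (hz₀ : z₀ ∈ Subsemigroup.corner (1 - p₀)) (hz₀_skew : star z₀ = -z₀)
    (h : ∀ p : H →L[ℂ] H, IsStarProjection p → IsFiniteRankOp p →
      p ∈ Subsemigroup.corner (1 - p₀) →
      (1 - p₀) * Δ p * (1 - p₀) = ⁅z₀, p⁆) :
    (∀ a : H →L[ℂ] H,
      (1 - p₀) * Δ ((1 - p₀) * a * (1 - p₀)) * (1 - p₀) = ⁅z₀, (1 - p₀) * a * (1 - p₀)⁆) ∧
    (p₀ = 0 → ∃ D : (H →L[ℂ] H) →ₗ[ℂ] (H →L[ℂ] H), IsAlgDerivation D ∧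
      ∀ a : H →L[ℂ] H, Δ a = D a ∧ D a = ⁅z₀, a⁆) := by
  have hq : IsStarProjection (1 - p₀) := hp₀.one_sub
  generalize hq_def : 1 - p₀ = q at hq hz₀ h ⊢
  have hcorner (a : H →L[ℂ] H) : q * a * q ∈ Subsemigroup.corner q := ⟨a, rfl⟩
  have hcompr (a : H →L[ℂ] H) :
      q * Δ (q * a * q) * q = ⁅z₀, q * a * q⁆ := by
    have hz := (hΔ.sub_lie z₀).compression_eq_zero hq (a := q * a * q) ?_ ?_
    · rwa [mul_sub, sub_mul, hq.isIdempotentElem.mul_lie_mul_of_mem_corner hz₀ (hcorner a),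
        sub_eq_zero] at hz
    · intro ξ hξ hqξ
      have hp := InnerProductSpace.isStarProjection_rankOne_self (𝕜 := ℂ) hξ
      have hqp : q * InnerProductSpace.rankOne ℂ ξ ξ = InnerProductSpace.rankOne ℂ ξ ξ := by
        ext x
        simp [hqξ]
      have hpq : InnerProductSpace.rankOne ℂ ξ ξ * q = InnerProductSpace.rankOne ℂ ξ ξ := by
        simpa [hp.isSelfAdjoint.star_eq, hq.isSelfAdjoint.star_eq] using congr(star $hqp)
      have hpc : InnerProductSpace.rankOne ℂ ξ ξ ∈ Subsemigroup.corner q :=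
        (Subsemigroup.mem_corner_iff hq.isIdempotentElem).2 ⟨hqp, hpq⟩
      have hfin : IsFiniteRankOp (InnerProductSpace.rankOne ℂ ξ ξ) := by
        refine Submodule.finiteDimensional_of_le (S₂ := Submodule.span ℂ {ξ}) ?_
        rintro _ ⟨x, rfl⟩
        exact Submodule.smul_mem _ _ (Submodule.mem_span_singleton_self ξ)
      rw [mul_sub, sub_mul, hq.isIdempotentElem.mul_lie_mul_of_mem_corner hz₀ hpc,
        h _ hp hfin hpc, sub_self]
    · have hqq := hq.isIdempotentElem.eq
      calc q * (q * a * q) * q = (q * q) * a * (q * q) := by simp only [mul_assoc]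
        _ = q * a * q := by rw [hqq]
  refine ⟨hcompr, fun hp => ⟨innerDerivation z₀, isAlgDerivation_innerDerivation z₀, fun a => ?_⟩⟩
  have ha := hcompr a
  simp only [← hq_def, hp, sub_zero, one_mul, mul_one] at ha
  exact ⟨by rw [ha, innerDerivation_apply], innerDerivation_apply z₀ a⟩
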